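/- A \emph{dynamical system with double recursion} is a tuple $\mathfrak S=(S,f,0,1)$ with $S$ a finite set, $f:S\times S\to S$ and $0,1\in S$. It is \emph{symmetric} if $f(x,y)=f(y,x)$ for all $x,y\in S$. Its \emph{development} is $a:\mathbb N\times\mathbb N\to S$ with $a(i,j)=1$ if $i=0$ or $j=0$, and $a(i,j)=f(a(i-1,j),a(i,j-1))$ if $i,j>0$. It is \emph{ultimately zero} if there is $N\in\mathbb N$ such that $a(i,j)=0$ for all $i,j>0$ with $i+j>N$. An \emph{instance of the Halting Problem} is a pair $(M,w)$, where $M=(\Sigma,Q,q_0,q_s,\bar b,\delta)$ is a Turing machine with finite alphabet $\Sigma$, finite set of states $Q$, start state $q_0\in Q$, stop state $q_s\in Q$, blank symbol $\bar b\in\Sigma$ and transition function $\delta:\Sigma\times Q\to\Sigma\times Q\times\{R,L,S\}$, and $w=w_1\dots w_n\in\Sigma^*$. The cells of the tape are indexed by $\mathbb Z$. The computation starts in state $q_0$ with $w_i$ in cell $i$ ($1\le i\le n$), all other cells blank, and the head on cell $0$. The machine stops when it reaches $q_s$. The negative side of the tape consists of the cells $z<0$, and the tape is \emph{clear} if all its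 cells contain $\bar b$. \textbf{Lemma.} There is an algorithm (a computable function on finite descriptions) that associates to every instance $(M,w)$ of the Halting Problem a symmetric dynamical system $\mathfrak S=(S,f,0,1)$ such that $\mathfrak S$ is ultimately zero if and only if, for input $w$, one of the following holds: (1) $M$ stops with clear tape without having done any step into the negative side of the tape; or (2) $M$ makes a step into the negative side of its tape, and the first time when $M$ makes such a step, the tape is clear. This holds both when "the tape" in (2) means the tape immediately after that first step, and, with a possibly different algorithm, when it means the tape immediately before that step. -/

import Mathlib

/-- A dynamical system with double recursion `(A, f, 0, 1)` on a set `A`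
(the theorem uses the finite sets `A = Fin n`). -/
structure DynSys (A : Type*) where
  /-- the recursion function -/
  f : A → A → A
  /-- the white colour `0` -/
  zero : A
  /-- the start symbol `1` -/
  one : A

namespace DynSys

variable {A : Type*}

/-- The system is symmetric: `f(x, y) = f(y, x)` for all `x, y`. -/
def IsSymmetric (S : DynSys A) : Prop := ∀ x y : A, S.f x y = S.f y x

/-- The development `a(i, j)`: it is `1` when `i = 0` or `j = 0`, and
`f(a(i-1, j), a(i, j-1))` otherwise. -/
def dev (S : DynSys A) : ℕ → ℕ → A
  | 0, _ => S.one
  | _ + 1, 0 => S.one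
  | i + 1, j + 1 => S.f (dev S i (j + 1)) (dev S (i + 1) j)

/-- The system is ultimately zero. -/
def UltimatelyZero (S : DynSys A) : Prop :=
  ∃ N : ℕ, ∀ i j : ℕ, 0 < i → 0 < j → N < i + j → S.dev i j = S.zero

/-- The finite description of a system on `Fin n`: the size `n`, the elements `0` and `1`, and
the table of values of `f`, row by row. -/
def code {n : ℕ} (S : DynSys (Fin n)) : ℕ × ℕ × ℕ × List (List ℕ) :=
  (n, (S.zero : ℕ), (S.one : ℕ),
    List.ofFn fun x : Fin n => List.ofFn fun y : Fin n => (S.f x y : ℕ))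

end DynSys

/-- The three possible head movements: left, stay, right. -/
inductive HeadMove where
  | L
  | S
  | R

namespace HeadMove

/-- The displacement of the head on the tape, whose cells are indexed by `ℤ`. -/
def shift : HeadMove → ℤ
  | L => -1
  | S => 0
  | R => 1

/-- The number that denotes a movement in the description of a machine. -/
def code : HeadMove → ℕ
  | L => 0
  | S => 1
  | R => 2

end HeadMove

/-- A Turing machine `(Σ, Q, q₀, q_s, b, δ)` with tape alphabet `Γ` (written `Σ` in the tuple) and set of
states `Q` (the theorem uses the finite sets `Γ = Fin k`, `Q = Fin m`). -/
structure TuringMachine (Γ Q : Type*) where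
  /-- the start state -/
  start : Q
  /-- the stop state -/
  halt : Q
  /-- the blank symbol -/
  blank : Γ
  /-- the transition function -/
  δ : Γ × Q → Γ × Q × HeadMove

namespace TuringMachine

variable {Γ Q : Type*}

/-- A configuration: the state, the position of the head, the contents of the two-way infinite
tape. -/
structure Config (Γ Q : Type*) where
  state : Q
  head : ℤ
  tape : ℤ → Γ

/-- The initial configuration on input `w = w₁ … wₙ`: the machine is in its start state, the letter
`wᵢ` is in cell `i`, all the other cells are blank, and the head is on cell `0`, the blank cell just
to the left of the input. -/
def init (M : TuringMachine Γ Q) (w : List Γ) : Config Γ Q where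
  state := M.start
  head := 0
  tape := fun z => if 1 ≤ z then w.getD (z - 1).toNat M.blank else M.blank

open Classical in
/-- One step of computation. A configuration in the stop state does not change any more. -/
noncomputable def step (M : TuringMachine Γ Q) (c : Config Γ Q) : Config Γ Q :=
  if c.state = M.halt then c
  else
    { state := (M.δ (c.tape c.head, c.state)).2.1
      head := c.head + (M.δ (c.tape c.head, c.state)).2.2.shift
      tape := Function.update c.tape c.head (M.δ (c.tape c.head, c.state)).1 }

/-- The configuration on input `w` at time `t`. -/
noncomputable def configAt (M : TuringMachine Γ Q) (w : List Γ) (t : ℕ) : Config Γ Q :=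
  M.step^[t] (M.init w)

/-- On input `w` the tape is clear (all its cells are blank) at time `t`. -/
def TapeClearAt (M : TuringMachine Γ Q) (w : List Γ) (t : ℕ) : Prop :=
  ∀ z : ℤ, (M.configAt w t).tape z = M.blank

/-- On input `w` the machine stops with clear tape, and its head never is on the negative side of
the tape (the cells `z < 0`) before it stops. -/
def StopsClearWithoutNegStep (M : TuringMachine Γ Q) (w : List Γ) : Prop :=
  ∃ t : ℕ, (M.configAt w t).state = M.halt ∧ M.TapeClearAt w t ∧
    ∀ s ≤ t, 0 ≤ (M.configAt w s).head

/-- On input `w`, the first step into the negative side of the tape is the one that leads from the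
configuration at time `t` to the configuration at time `t + 1`. -/
def FirstNegStepAt (M : TuringMachine Γ Q) (w : List Γ) (t : ℕ) : Prop :=
  (∀ s ≤ t, 0 ≤ (M.configAt w s).head) ∧ (M.configAt w (t + 1)).head < 0

/-- The finite description of an instance `(M, w)` of the halting problem, for a machine `M` with
alphabet `Fin k` and set of states `Fin m`: the numbers `k` and `m`, the start state, the stop
state, the blank symbol, the table of `δ`, row by row, and the word `w`. -/
def instanceCode {k m : ℕ} (M : TuringMachine (Fin k) (Fin m)) (w : List (Fin k)) :
    (ℕ × ℕ × ℕ × ℕ × ℕ × List (List (ℕ × ℕ × ℕ))) × List ℕ :=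
  ((k, m, (M.start : ℕ), (M.halt : ℕ), (M.blank : ℕ),
    List.ofFn fun a : Fin k => List.ofFn fun q : Fin m =>
      (((M.δ (a, q)).1 : ℕ), ((M.δ (a, q)).2.1 : ℕ), (M.δ (a, q)).2.2.code)),
    w.map Fin.val)

end TuringMachine

/-! The antidiagonals of the development serve as time. After an initial phase, odd antidiagonals
carry the cells of a one-sided cellular automaton: `dev i (i + 2z + 1)` is cell `z` at time `τ = i +
z - lead`. Even antidiagonals carry unordered pairs of adjacent cells: `dev i (i + 2z)` is the pair
of cells `z - 1` and `z`. Two consecutive pairs share their middle cell, so a symmetric `f` can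
recover that cell and the unordered set of its two neighbours. This is enough for a local rule that
is invariant under reflection. The diagonal folds the quarter plane, which makes cell `0` its own
left neighbour.

Two devices compensate for the lost orientation. Every nonblank or marked cell carries its position
modulo `3`, so distinct neighbours of a cell cannot be confused unless both are `0`
(`separated_instanceCode`, used in `common_eq`). The head knows on which side its previous position,
the companion, lies, and the companion is marked, so each neighbour of the head can tell whether the
head moves towards it. The input is produced by letting the first antidiagonals compute their own
coordinates (`dev_label`).

The automaton simulates the machine (`Running.succ`) until it halts or leaves cell `0` to the left.
A head in cell `0` detects the latter by seeing itself as a neighbour. In both cases all marks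
disappear and the tape freezes. Hence the cells are eventually all `0` exactly if the frozen tape is
blank; a machine that runs forever on the nonnegative side always shows a nonzero head
(`eventually_zero_iff`). Only boundedly many states occur, with a computable bound, so the table can
be truncated to a finite system (`finSys_dev`). -/

/-- Finite descriptions of instances of the halting problem. -/
abbrev InstCode := (ℕ × ℕ × ℕ × ℕ × ℕ × List (List (ℕ × ℕ × ℕ))) × List ℕ

namespace InstCode

def startOf (c : InstCode) : ℕ := c.1.2.2.1
def haltOf (c : InstCode) : ℕ := c.1.2.2.2.1
def blankOf (c : InstCode) : ℕ := c.1.2.2.2.2.1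
def deltaOf (c : InstCode) (a q : ℕ) : ℕ × ℕ × ℕ :=
  (c.1.2.2.2.2.2.getD a []).getD q (0, 0, 0)

/-! ### Cells

A cell is a number: `0` for a blank cell without marks, and otherwise a packed tuple of its position
modulo `3`, its symbol, its role (`0`: none, `1`: companion of the head, i.e. the previous position
of the head, `2`, `3`: head with companion to the left, right) and its state. -/

/-- Blank unmarked cells must be `0` for the system to become ultimately zero; the price is that
they forget their phase. -/
def packCell (b ph a r q : ℕ) : ℕ :=
  if a = b ∧ r = 0 then 0 else Nat.pair (Nat.pair ph a) (Nat.pair r q) + 1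

def phase (x : ℕ) : ℕ := (x - 1).unpair.1.unpair.1
def symb (b x : ℕ) : ℕ := if x = 0 then b else (x - 1).unpair.1.unpair.2
def role (x : ℕ) : ℕ := (x - 1).unpair.2.unpair.1
def stateOf (x : ℕ) : ℕ := (x - 1).unpair.2.unpair.2

def headPart (x : ℕ) : ℕ := if 2 ≤ role x then x else 0

/-- The head among a cell `y` and its neighbours `x`, `w` (or `0`). -/
def headNear (x y w : ℕ) : ℕ := if 2 ≤ role y then y else max (headPart x) (headPart w)

def action (c : InstCode) (x : ℕ) : ℕ × ℕ × ℕ := c.deltaOf (symb c.blankOf x) (stateOf x)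

/-- The new contents of a head cell `y` with neighbours `x`, `w`. A neighbour equal to `y` is its
mirror image. -/
def headRule (c : InstCode) (d x y w : ℕ) : ℕ :=
  if (c.action y).2.2 = 1 then
    packCell c.blankOf (phase y) (c.action y).1 (role y) (c.action y).2.1
  else if (c.action y).2.2 = 0 ∧ (x = y ∨ w = y) then
    -- The head leaves through the mirror at cell `0`. The parameter `d` selects whether the frozen
    -- tape is the one before or after the write.
    packCell c.blankOf (phase y) (if d = 0 then symb c.blankOf y else (c.action y).1) 0 0
  else packCell c.blankOf (phase y) (c.action y).1 1 0

/-- The new contents of a cell `y` next to the head `h`. -/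
def nearRule (c : InstCode) (h y : ℕ) : ℕ :=
  if (c.action h).2.2 = 1 then y
  -- Moves are coded `0` (left) and `2` (right). The companion is entered by the move to its side,
  -- the other neighbour by the opposite move. The new phase is computed from that of the head, as a
  -- blank `y` has none.
  else if (c.action h).2.2 = (if role y = 1 then 2 * (role h - 2) else 2 * (3 - role h)) then
    packCell c.blankOf ((phase h + (if (c.action h).2.2 = 0 then 2 else 1)) % 3)
      (symb c.blankOf y) (if (c.action h).2.2 = 0 then 3 else 2) (c.action h).2.1
  else packCell c.blankOf (phase y) (symb c.blankOf y) 0 0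

/-- The new contents of a cell `y` with neighbours `x`, `w`. -/
def localRule (c : InstCode) (d x y w : ℕ) : ℕ :=
  if headNear x y w = 0 then y
  else if stateOf (headNear x y w) = c.haltOf then
    packCell c.blankOf (phase y) (symb c.blankOf y) 0 0
  else if 2 ≤ role y then c.headRule d x y w
  else c.nearRule (headNear x y w) y

/-- Although the head has no previous position, cell `1` is declared its companion: a head in cell
`0` then always has its companion on the right. -/
def initCell (c : InstCode) (z : ℕ) : ℕ :=
  packCell c.blankOf (z % 3) (if z = 0 then c.blankOf else c.2.getD (z - 1) c.blankOf)
    (if z = 0 then 3 else if z = 1 then 1 else 0) (if z = 0 then c.startOf else 0)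

/-- The contents of cell `z` after `τ` steps of the local rule. The left neighbour of cell `0` is
its mirror image, cell `0`. -/
def cellAt (c : InstCode) (d : ℕ) : ℕ → ℕ → ℕ
  | 0, z => c.initCell z
  | τ + 1, z => c.localRule d (cellAt c d τ (z - 1)) (cellAt c d τ z) (cellAt c d τ (z + 1))

/-! ### States of the dynamical system -/

/-- The kind `k` is `1` for a cell, `2` for a pair of cells, `3` for a label. The state `0` is both
the blank cell and the blank pair. -/
def st (k u v : ℕ) : ℕ := Nat.pair k (Nat.pair u v)
def kd (s : ℕ) : ℕ := s.unpair.1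
def lo (s : ℕ) : ℕ := s.unpair.2.unpair.1
def hi (s : ℕ) : ℕ := s.unpair.2.unpair.2

def cellSt (x : ℕ) : ℕ := if x = 0 then 0 else st 1 x 0
def pairSt (x y : ℕ) : ℕ := if max x y = 0 then 0 else st 2 (min x y) (max x y)

/-- Half of the number of the last antidiagonal that carries labels. -/
def lead (c : InstCode) : ℕ := c.2.length + 2

/-- On the antidiagonal `2 * lead + 1` the difference `j - i` is odd, `2z + 1`, and the labels give
way to the initial cells `z`. -/
def labelSt (c : InstCode) (i j : ℕ) : ℕ :=
  if i + j < 2 * c.lead + 1 then st 3 i j else cellSt (c.initCell ((j - i) / 2))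

/-- The three cases are a predecessor on the border (whose label is `(0, 0)`), a point on the
diagonal with two equal predecessors `(i, i + 1)`, and predecessors `(i - 1, j)`, `(i, j - 1)` in
either order. -/
def labelRule (c : InstCode) (u v u' v' : ℕ) : ℕ :=
  if v = 0 ∨ v' = 0 then c.labelSt 1 (max v v' + 1)
  else if u = u' then c.labelSt (max v v') (max v v')
  else c.labelSt (max u u') (max v v')

/-- The common element of the unordered pairs `{u, v}` and `{u', v'}`. -/
def common (u v u' v' : ℕ) : ℕ :=
  if u = u' ∧ v = v' then v else if u = u' ∨ u = v' then u else v

def pairRule (c : InstCode) (d u v u' v' : ℕ) : ℕ :=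
  c.localRule d (u + v - common u v u' v') (common u v u' v') (u' + v' - common u v u' v')

/-- The border state `st 3 0 0` has zero components, so next to a cell or a pair it acts as a blank
one. -/
def rawRule (c : InstCode) (d s t : ℕ) : ℕ :=
  if kd s = 3 ∧ kd t = 3 then c.labelRule (lo s) (hi s) (lo t) (hi t)
  else if kd s = 2 ∨ kd t = 2 then cellSt (c.pairRule d (lo s) (hi s) (lo t) (hi t))
  else pairSt (lo s) (lo t)

def rule (c : InstCode) (d s t : ℕ) : ℕ := c.rawRule d (min s t) (max s t)

/-- The dynamical system of an instance, on all natural numbers. -/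
def sys (c : InstCode) (d : ℕ) : DynSys ℕ := ⟨c.rule d, 0, st 3 0 0⟩

/-! ### Values of the recursion function on labels, cells and pairs -/

@[simp] theorem kd_st (k u v : ℕ) : kd (st k u v) = k := by simp [kd, st]
@[simp] theorem lo_st (k u v : ℕ) : lo (st k u v) = u := by simp [lo, st]
@[simp] theorem hi_st (k u v : ℕ) : hi (st k u v) = v := by simp [hi, st]
@[simp] theorem kd_zero : kd 0 = 0 := by simp [kd]
@[simp] theorem lo_zero : lo 0 = 0 := by simp [lo]
@[simp] theorem hi_zero : hi 0 = 0 := by simp [hi]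

theorem st_ne_zero {k u v : ℕ} (hk : k ≠ 0) : st k u v ≠ 0 := fun h => hk (by
  rw [← kd_st k u v, h, kd_zero])

theorem cellSt_eq_zero {x : ℕ} : cellSt x = 0 ↔ x = 0 := by
  unfold cellSt
  split_ifs with h
  · simp [h]
  · simp [h, st_ne_zero]

theorem rule_comm (c : InstCode) (d s t : ℕ) : c.rule d s t = c.rule d t s := by
  rw [rule, rule, min_comm, max_comm]

theorem rule_eq_of {c : InstCode} {d s t r : ℕ} (h₁ : c.rawRule d s t = r)
    (h₂ : c.rawRule d t s = r) : c.rule d s t = r := by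
  rcases le_total s t with h | h
  · rw [rule, min_eq_left h, max_eq_right h, h₁]
  · rw [rule, min_eq_right h, max_eq_left h, h₂]

theorem rule_label (c : InstCode) (d u v u' v' : ℕ) :
    c.rule d (st 3 u v) (st 3 u' v') = c.labelRule u v u' v' := by
  apply rule_eq_of
  · simp [rawRule]
  · simp [rawRule, labelRule, max_comm, or_comm, eq_comm]

theorem headNear_comm (x y w : ℕ) : headNear x y w = headNear w y x := by
  rw [headNear, headNear, max_comm]

theorem headRule_comm (c : InstCode) (d x y w : ℕ) : c.headRule d x y w = c.headRule d w y x := by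
  unfold headRule
  split_ifs <;> first | rfl | (exfalso; tauto)

theorem localRule_comm (c : InstCode) (d x y w : ℕ) :
    c.localRule d x y w = c.localRule d w y x := by
  rw [localRule, localRule, headNear_comm x y w, headRule_comm c d x y w]

theorem localRule_zero (c : InstCode) (d : ℕ) : c.localRule d 0 0 0 = 0 := by
  simp [localRule, headNear, headPart, role]

/-- The state `s` stands for the cell `x`. -/
def IsCell (s x : ℕ) : Prop := s = cellSt x ∨ (s = st 3 0 0 ∧ x = 0)

/-- The state `s` stands for the pair of the cells `x` and `y`. -/
def IsPair (s x y : ℕ) : Prop := s = pairSt x y ∨ (s = st 3 0 0 ∧ x = 0 ∧ y = 0)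

theorem kd_cellSt (x : ℕ) : kd (cellSt x) ≠ 2 ∧ kd (cellSt x) ≠ 3 ∧ lo (cellSt x) = x := by
  unfold cellSt; split_ifs with h <;> simp [h]

theorem IsCell.spec {s x : ℕ} (h : IsCell s x) : kd s ≠ 2 ∧ lo s = x := by
  rcases h with rfl | ⟨rfl, rfl⟩
  · exact ⟨(kd_cellSt x).1, (kd_cellSt x).2.2⟩
  · simp

theorem pairSt_comm (x y : ℕ) : pairSt x y = pairSt y x := by
  simp only [pairSt, max_comm, min_comm]

theorem rule_cell (c : InstCode) (d : ℕ) {s x : ℕ} (h : IsCell s x) (y : ℕ) :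
    c.rule d s (cellSt y) = pairSt x y := by
  obtain ⟨h1, h2⟩ := h.spec
  obtain ⟨h3, h4, h5⟩ := kd_cellSt y
  apply rule_eq_of
  · simp [rawRule, *]
  · simp [rawRule, *, pairSt_comm]

theorem pairSt_spec (x y : ℕ) : kd (pairSt x y) ≠ 3 ∧ (kd (pairSt x y) = 2 ∨ (x = 0 ∧ y = 0)) ∧
    lo (pairSt x y) = min x y ∧ hi (pairSt x y) = max x y := by
  unfold pairSt; split_ifs with h
  · simp; omega
  · simp

theorem IsPair.spec {s x y : ℕ} (h : IsPair s x y) : (kd s = 2 ∨ (x = 0 ∧ y = 0)) ∧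
    lo s = min x y ∧ hi s = max x y := by
  rcases h with rfl | ⟨rfl, rfl, rfl⟩
  · exact (pairSt_spec x y).2
  · simp

/-- If `x ≠ w`, the pairs either differ and share only `y`, or `y` is visible by comparison. If `x =
w`, the pairs coincide and the larger element is taken, which is `y` because `x` is `y` or `0`. -/
theorem common_eq {x y w : ℕ} (h : x = w → x = y ∨ x = 0) :
    common (min x y) (max x y) (min y w) (max y w) = y := by
  unfold common; split_ifs <;> omega

theorem rawRule_pair (c : InstCode) (d : ℕ) {s t x y w : ℕ} (h : x = w → x = y ∨ x = 0)
    (hst : kd s ≠ 3 ∨ kd t ≠ 3)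
    (hs : (kd s = 2 ∨ (x = 0 ∧ y = 0)) ∧ lo s = min x y ∧ hi s = max x y)
    (ht : (kd t = 2 ∨ (y = 0 ∧ w = 0)) ∧ lo t = min y w ∧ hi t = max y w) :
    c.rawRule d s t = cellSt (c.localRule d x y w) := by
  obtain ⟨hs1, hs2, hs3⟩ := hs
  obtain ⟨ht1, ht2, ht3⟩ := ht
  rw [rawRule, if_neg (fun e => hst.elim (· e.1) (· e.2))]
  split_ifs with h2
  · rw [pairRule, hs2, hs3, ht2, ht3, common_eq h, show min x y + max x y - y = x by omega,
      show min y w + max y w - y = w by omega]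
  -- Neither state has kind `2`, so both pairs are blank. The cell branch is then used, and it also
  -- yields `0`.
  · obtain ⟨rfl, rfl⟩ := hs1.resolve_left fun e => h2 (Or.inl e)
    have hw : w = 0 := (ht1.resolve_left fun e => h2 (Or.inr e)).2
    subst hw
    rw [hs2, ht2, localRule_zero]
    simp [pairSt, cellSt]

theorem rule_pair (c : InstCode) (d : ℕ) {s x y w : ℕ} (h : x = w → x = y ∨ x = 0)
    (hs : IsPair s y w) : c.rule d s (pairSt x y) = cellSt (c.localRule d x y w) := by
  obtain ⟨h1, h2⟩ := pairSt_spec x y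
  apply rule_eq_of
  · rw [localRule_comm]
    refine rawRule_pair c d (fun e => ?_) (Or.inr h1) ?_ ?_
    · have := h e.symm; omega
    · have := hs.spec; rwa [min_comm, max_comm, and_comm (a := w = 0)]
    · rwa [min_comm, max_comm, and_comm (a := y = 0)]
  · exact rawRule_pair c d h (Or.inl h1) h2 hs.spec

end InstCode

/-! ### The development, antidiagonal by antidiagonal -/

theorem DynSys.IsSymmetric.dev_comm {A : Type*} {S : DynSys A} (hS : S.IsSymmetric) (i j : ℕ) :
    S.dev i j = S.dev j i := by
  induction i generalizing j with
  | zero => cases j <;> simp [DynSys.dev]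
  | succ i ih =>
    induction j with
    | zero => simp [DynSys.dev]
    | succ j ih' => rw [DynSys.dev, DynSys.dev, ih, ih', hS]

namespace InstCode

theorem sys_isSymmetric (c : InstCode) (d : ℕ) : (c.sys d).IsSymmetric := rule_comm c d

theorem dev_succ (c : InstCode) (d i j : ℕ) : (c.sys d).dev (i + 1) (j + 1) =
    c.rule d ((c.sys d).dev i (j + 1)) ((c.sys d).dev (i + 1) j) := by
  rw [DynSys.dev]; rfl

theorem dev_zero_left (c : InstCode) (d j : ℕ) : (c.sys d).dev 0 j = st 3 0 0 := by
  rw [DynSys.dev]; rfl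

theorem dev_zero_right (c : InstCode) (d i : ℕ) : (c.sys d).dev i 0 = st 3 0 0 := by
  rw [(sys_isSymmetric c d).dev_comm, dev_zero_left]

theorem dev_label (c : InstCode) (d : ℕ) (n : ℕ) : ∀ i j, i + j = n → 1 ≤ i → i ≤ j →
    i + j ≤ 2 * c.lead + 1 → (c.sys d).dev i j = c.labelSt i j := by
  induction n using Nat.strong_induction_on with
  | _ n ih =>
    have key : ∀ i j, i + j < n → 1 ≤ i → i ≤ j → i + j < 2 * c.lead + 1 →
        (c.sys d).dev i j = st 3 i j := by
      intro i j h1 h2 h3 h4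
      rw [ih _ h1 i j rfl h2 h3 h4.le, labelSt, if_pos h4]
    intro i j hn hi hij hL
    obtain ⟨i, rfl⟩ : ∃ i', i = i' + 1 := ⟨i - 1, by omega⟩
    obtain ⟨j, rfl⟩ : ∃ j', j = j' + 1 := ⟨j - 1, by omega⟩
    rw [dev_succ]
    rcases Nat.eq_zero_or_pos i with rfl | hi0
    · rw [dev_zero_left]
      rcases Nat.eq_zero_or_pos j with rfl | hj0
      · rw [dev_zero_right, rule_label]; simp [labelRule]
      · rw [key (0 + 1) j (by omega) (by omega) (by omega) (by omega), rule_label]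
        simp [labelRule]
    · rw [key i (j + 1) (by omega) (by omega) (by omega) (by omega)]
      rcases hij.eq_or_lt with h | h
      · obtain rfl : i = j := by omega
        rw [(sys_isSymmetric c d).dev_comm, key i (i + 1) (by omega) (by omega) (by omega)
          (by omega), rule_label]
        simp [labelRule]
      · rw [key (i + 1) j (by omega) (by omega) (by omega) (by omega), rule_label]
        rw [labelRule, if_neg (by omega), if_neg (by omega)]
        congr 1 <;> omega

/-- The input ends at cell `length`, and the companion mark occupies cell `1` even when the input is
empty; `lead` lies beyond both. -/
theorem initCell_eq_zero (c : InstCode) {z : ℕ} (hz : c.lead ≤ z) : c.initCell z = 0 := by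
  unfold lead at hz
  have h : c.2.getD (z - 1) c.blankOf = c.blankOf := by
    rw [List.getD_eq_default]; omega
  rw [initCell, packCell, if_pos]
  rw [if_neg (by omega), if_neg (by omega), if_neg (by omega)]
  exact ⟨h, rfl⟩

/-- Information travels one cell per step. The border of the quarter plane meets the antidiagonals
exactly in this blank zone, so the constant border value does no harm. -/
theorem cellAt_eq_zero (c : InstCode) (d τ : ℕ) : ∀ z, c.lead + τ ≤ z → c.cellAt d τ z = 0 := by
  induction τ with
  | zero => exact fun z hz => c.initCell_eq_zero hz
  | succ τ ih =>
    intro z hz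
    rw [cellAt, ih _ (by omega), ih _ (by omega), ih _ (by omega), localRule_zero]

/-- Neighbours of a common cell are told apart. -/
def Separated (c : InstCode) (d : ℕ) : Prop := ∀ τ z,
  c.cellAt d τ (z - 1) = c.cellAt d τ (z + 1) →
    c.cellAt d τ (z - 1) = c.cellAt d τ z ∨ c.cellAt d τ (z - 1) = 0

theorem dev_pair_of_cell {c : InstCode} {d τ : ℕ}
    (ih : ∀ z i, 1 ≤ i → i + z = c.lead + τ →
      (c.sys d).dev i (i + 2 * z + 1) = cellSt (c.cellAt d τ z)) :
    ∀ z i, 1 ≤ i → i + z = c.lead + 1 + τ →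
      (c.sys d).dev i (i + 2 * z) = pairSt (c.cellAt d τ (z - 1)) (c.cellAt d τ z) := by
  intro z i hi hz
  obtain ⟨i, rfl⟩ : ∃ i', i = i' + 1 := ⟨i - 1, by omega⟩
  have hc : IsCell ((c.sys d).dev i (i + 2 * z + 1)) (c.cellAt d τ z) := by
    rcases Nat.eq_zero_or_pos i with rfl | hi0
    · exact Or.inr ⟨dev_zero_left _ _ _, cellAt_eq_zero _ _ _ _ (by omega)⟩
    · exact Or.inl (ih z i hi0 (by omega))
  rw [show i + 1 + 2 * z = (i + 2 * z) + 1 by ring, dev_succ]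
  rcases Nat.eq_zero_or_pos z with rfl | hz0
  -- On the diagonal both predecessors are copies of cell `0`; truncated subtraction makes `z - 1`
  -- that same cell.
  · have : 1 ≤ i := by unfold lead at hz; omega
    rw [(sys_isSymmetric c d).dev_comm (i + 1)]
    have h0 := ih 0 i this (by omega)
    simp only [Nat.mul_zero, Nat.add_zero] at h0 hc ⊢
    nth_rewrite 2 [h0]
    rw [rule_cell c d hc]
  · have h1 := ih (z - 1) (i + 1) (by omega) (by omega)
    rw [show i + 1 + 2 * (z - 1) + 1 = i + 2 * z by omega] at h1
    rw [h1, rule_cell c d hc, pairSt_comm]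

theorem dev_cell {c : InstCode} {d : ℕ} (hsep : c.Separated d) (τ : ℕ) :
    ∀ z i, 1 ≤ i → i + z = c.lead + τ →
      (c.sys d).dev i (i + 2 * z + 1) = cellSt (c.cellAt d τ z) := by
  induction τ with
  | zero =>
    intro z i hi hz
    rw [dev_label c d _ i _ rfl hi (by omega) (by omega), labelSt, if_neg (by omega), cellAt]
    congr 2; omega
  | succ τ ih =>
    have hp := dev_pair_of_cell ih
    intro z i hi hz
    obtain ⟨i, rfl⟩ : ∃ i', i = i' + 1 := ⟨i - 1, by omega⟩
    rw [dev_succ, hp z (i + 1) hi (by omega), cellAt]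
    apply rule_pair c d (hsep τ z)
    rcases Nat.eq_zero_or_pos i with rfl | hi0
    · exact Or.inr ⟨dev_zero_left _ _ _, cellAt_eq_zero _ _ _ _ (by omega),
        cellAt_eq_zero _ _ _ _ (by omega)⟩
    · have := hp (z + 1) i hi0 (by omega)
      rw [Nat.add_sub_cancel, show i + 2 * (z + 1) = i + 1 + 2 * z + 1 by ring] at this
      exact Or.inl this

theorem dev_pair {c : InstCode} {d : ℕ} (hsep : c.Separated d) (τ : ℕ) :
    ∀ z i, 1 ≤ i → i + z = c.lead + 1 + τ →
      (c.sys d).dev i (i + 2 * z) = pairSt (c.cellAt d τ (z - 1)) (c.cellAt d τ z) :=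
  dev_pair_of_cell (dev_cell hsep τ)

theorem ultimatelyZero_sys_iff {c : InstCode} {d : ℕ} (hsep : c.Separated d) :
    (c.sys d).UltimatelyZero ↔ ∃ T, ∀ τ, T ≤ τ → ∀ z, c.cellAt d τ z = 0 := by
  constructor
  · rintro ⟨N, hN⟩
    refine ⟨N, fun τ hτ z => ?_⟩
    rcases le_or_gt (c.lead + τ) z with h | h
    · exact cellAt_eq_zero _ _ _ _ h
    · have h1 := dev_cell hsep τ z (c.lead + τ - z) (by omega) (by omega)
      rw [hN _ _ (by omega) (by omega) (by omega)] at h1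
      exact cellSt_eq_zero.1 h1.symm
  · rintro ⟨T, hT⟩
    refine ⟨2 * (c.lead + T) + 2, ?_⟩
    have key : ∀ i j, 0 < i → i ≤ j → 2 * (c.lead + T) + 2 < i + j → (c.sys d).dev i j = 0 := by
      intro i j hi hij hN
      obtain ⟨e, rfl⟩ := Nat.exists_eq_add_of_le hij
      rcases Nat.even_or_odd' e with ⟨z, rfl | rfl⟩
      · rw [dev_pair hsep (i + z - c.lead - 1) z i hi (by omega), hT _ (by omega),
          hT _ (by omega)]
        rfl
      · rw [← add_assoc, dev_cell hsep (i + z - c.lead) z i hi (by omega), hT _ (by omega)]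
        rfl
    intro i j hi hj hN
    rcases le_total i j with h | h
    · exact key i j hi h hN
    · rw [(sys_isSymmetric c d).dev_comm]
      exact key j i hj h (by omega)

/-! ### Bounds for the states that occur -/

theorem st_lt {B k u v : ℕ} (hk : k < B) (hu : u < B) (hv : v < B) : st k u v < (B * B) * (B * B) := by
  have h1 : Nat.pair u v < B * B := by
    refine (Nat.pair_lt_max_add_one_sq u v).trans_le ?_
    rw [sq]; exact Nat.mul_self_le_mul_self (by omega)
  have h2 : B ≤ B * B := Nat.le_mul_self B
  refine (Nat.pair_lt_max_add_one_sq k _).trans_le ?_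
  rw [sq]; exact Nat.mul_self_le_mul_self (by omega)

theorem cellSt_lt {B x : ℕ} (hB : 4 ≤ B) (hx : x < B) : cellSt x < (B * B) * (B * B) := by
  unfold cellSt
  split_ifs
  · positivity
  · exact st_lt (by omega) hx (by omega)

theorem pairSt_lt {B x y : ℕ} (hB : 4 ≤ B) (hx : x < B) (hy : y < B) :
    pairSt x y < (B * B) * (B * B) := by
  unfold pairSt
  split_ifs
  · positivity
  · exact st_lt (by omega) (by omega) (by omega)

theorem dev_lt {c : InstCode} {d B : ℕ} (hsep : c.Separated d) (hB : 2 * c.lead + 1 ≤ B)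
    (hc : ∀ τ z, c.cellAt d τ z < B) (i j : ℕ) : (c.sys d).dev i j < (B * B) * (B * B) := by
  have hB4 : 4 ≤ B := by unfold lead at hB; omega
  wlog hij : i ≤ j generalizing i j
  · rw [(sys_isSymmetric c d).dev_comm]
    exact this j i (by omega)
  rcases Nat.eq_zero_or_pos i with rfl | hi
  · rw [dev_zero_left]; exact st_lt (by omega) (by omega) (by omega)
  rcases lt_or_ge (i + j) (2 * c.lead + 1) with h | h
  · rw [dev_label c d _ i j rfl hi hij h.le, labelSt, if_pos h]
    exact st_lt (by omega) (by omega) (by omega)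
  · obtain ⟨e, rfl⟩ := Nat.exists_eq_add_of_le hij
    rcases Nat.even_or_odd' e with ⟨z, rfl | rfl⟩
    · rw [dev_pair hsep (i + z - c.lead - 1) z i hi (by omega)]
      exact pairSt_lt hB4 (hc _ _) (hc _ _)
    · rw [← add_assoc, dev_cell hsep (i + z - c.lead) z i hi (by omega)]
      exact cellSt_lt hB4 (hc _ _)

end InstCode

/-! ### The local rule on encoded configurations -/

namespace InstCode

theorem packCell_blank (b ph q : ℕ) : packCell b ph b 0 q = 0 := if_pos ⟨rfl, rfl⟩

theorem packCell_eq_zero {b ph a r q : ℕ} : packCell b ph a r q = 0 ↔ a = b ∧ r = 0 := by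
  unfold packCell; split_ifs with h <;> simp [h]

theorem phase_packCell {b ph a r q : ℕ} (h : packCell b ph a r q ≠ 0) :
    phase (packCell b ph a r q) = ph := by
  rw [Ne, packCell_eq_zero] at h
  rw [packCell, if_neg h]; simp [phase]

@[simp] theorem symb_packCell (b ph a r q : ℕ) : symb b (packCell b ph a r q) = a := by
  unfold packCell; split_ifs with h <;> simp [symb, h]

@[simp] theorem role_packCell (b ph a r q : ℕ) : role (packCell b ph a r q) = r := by
  unfold packCell; split_ifs with h <;> simp [role, h]

theorem stateOf_packCell {b ph a r q : ℕ} (h : r ≠ 0) : stateOf (packCell b ph a r q) = q := by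
  rw [packCell, if_neg (by tauto)]; simp [stateOf]

/-- The cell `z` without its marks. -/
theorem packCell_phase (b ph a r q : ℕ) :
    packCell b (phase (packCell b ph a r q)) a 0 0 = packCell b ph a 0 0 := by
  by_cases h : packCell b ph a r q = 0
  · rw [packCell_eq_zero] at h
    rw [h.1, packCell_blank, packCell_blank]
  · rw [phase_packCell h]

/-- The role of cell `z` when the head is in cell `h` with role `r`. -/
def roleAt (h r z : ℕ) : ℕ :=
  if z = h then r else if (r = 2 ∧ z + 1 = h) ∨ (r = 3 ∧ z = h + 1) then 1 else 0

/-- Cell `z` of the tape `T`, with the head in cell `h`, in state `q` and with role `r`. -/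
def encCell (b : ℕ) (T : ℕ → ℕ) (h r q z : ℕ) : ℕ :=
  packCell b (z % 3) (T z) (roleAt h r z) (if z = h then q else 0)

def plainCell (b : ℕ) (T : ℕ → ℕ) (z : ℕ) : ℕ := packCell b (z % 3) (T z) 0 0

theorem roleAt_self (h r : ℕ) : roleAt h r h = r := if_pos rfl

theorem roleAt_le {h r z : ℕ} (hz : z ≠ h) : roleAt h r z ≤ 1 := by
  rw [roleAt, if_neg hz]; split_ifs <;> simp

theorem roleAt_eq_one {h r z : ℕ} (hz : z ≠ h) :
    roleAt h r z = 1 ↔ (r = 2 ∧ z + 1 = h) ∨ (r = 3 ∧ z = h + 1) := by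
  rw [roleAt, if_neg hz]; split_ifs with h1 <;> simp [h1]

section
variable {c : InstCode} {d : ℕ} {T : ℕ → ℕ} {h r q : ℕ}

theorem role_encCell (b z : ℕ) : role (encCell b T h r q z) = roleAt h r z := by
  simp [encCell]

theorem symb_encCell (b z : ℕ) : symb b (encCell b T h r q z) = T z := by
  simp [encCell]

theorem phase_encCell_self (b : ℕ) (hr : 2 ≤ r) : phase (encCell b T h r q h) = h % 3 := by
  rw [encCell, phase_packCell]
  rw [Ne, packCell_eq_zero, roleAt_self]; omega

theorem stateOf_encCell_self (b : ℕ) (hr : 2 ≤ r) : stateOf (encCell b T h r q h) = q := by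
  rw [encCell, stateOf_packCell, if_pos rfl]
  rw [roleAt_self]; omega

theorem plain_phase_encCell (b z : ℕ) :
    packCell b (phase (encCell b T h r q z)) (T z) 0 0 = plainCell b T z :=
  packCell_phase _ _ _ _ _

theorem headPart_encCell (b : ℕ) (hr : 2 ≤ r) (z : ℕ) :
    headPart (encCell b T h r q z) = if z = h then encCell b T h r q h else 0 := by
  unfold headPart
  rw [role_encCell]
  split_ifs with h1 h2 h2
  · rw [h2]
  · have := roleAt_le (r := r) h2; omega
  · rw [h2, roleAt_self] at h1; omega
  · rfl

theorem encCell_self_ne_zero (b : ℕ) (hr : 2 ≤ r) : encCell b T h r q h ≠ 0 := by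
  rw [Ne, encCell, packCell_eq_zero, roleAt_self]; omega

/-- There is only one head, so the maximum in `headNear` selects it; at `z = 0` the mirror image
merely repeats cell `0`. -/
theorem headNear_encCell (b : ℕ) (hr : 2 ≤ r) (z : ℕ) :
    headNear (encCell b T h r q (z - 1)) (encCell b T h r q z) (encCell b T h r q (z + 1)) =
      if z = h ∨ z + 1 = h ∨ z = h + 1 then encCell b T h r q h else 0 := by
  unfold headNear
  rw [role_encCell, headPart_encCell b hr, headPart_encCell b hr]
  by_cases h1 : z = h
  · rw [h1, roleAt_self, if_pos hr, if_pos (Or.inl rfl)]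
  · have := roleAt_le (r := r) h1
    rw [if_neg (by omega)]
    by_cases h2 : z + 1 = h
    · rw [if_neg (by omega), if_pos h2, if_pos (by omega)]; simp
    · rw [if_neg h2]
      by_cases h3 : z = h + 1
      · rw [if_pos (by omega), if_pos (by omega)]; simp
      · rw [if_neg (by omega), if_neg (by omega)]; rfl

theorem action_encCell (hr : 2 ≤ r) :
    c.action (encCell c.blankOf T h r q h) = c.deltaOf (T h) q := by
  rw [action, symb_encCell, stateOf_encCell_self _ hr]

/-- The local rule around cell `z`. -/
def localAt (c : InstCode) (d : ℕ) (E : ℕ → ℕ) (z : ℕ) : ℕ :=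
  c.localRule d (E (z - 1)) (E z) (E (z + 1))

theorem localAt_plain (z : ℕ) :
    c.localAt d (plainCell c.blankOf T) z = plainCell c.blankOf T z := by
  simp [localAt, localRule, headNear, headPart, plainCell]

theorem localAt_far (hr : 2 ≤ r) {z : ℕ} (hz : ¬(z = h ∨ z + 1 = h ∨ z = h + 1)) :
    c.localAt d (encCell c.blankOf T h r q) z = encCell c.blankOf T h r q z := by
  rw [localAt, localRule, headNear_encCell _ hr, if_neg hz, if_pos rfl]

theorem localAt_head (hr : 2 ≤ r) (hq : q ≠ c.haltOf) :
    c.localAt d (encCell c.blankOf T h r q) h =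
      c.headRule d (encCell c.blankOf T h r q (h - 1)) (encCell c.blankOf T h r q h)
        (encCell c.blankOf T h r q (h + 1)) := by
  rw [localAt, localRule, headNear_encCell _ hr, if_pos (Or.inl rfl),
    if_neg (encCell_self_ne_zero _ hr), stateOf_encCell_self _ hr, if_neg hq, role_encCell,
    roleAt_self, if_pos hr]

theorem localAt_near (hr : 2 ≤ r) (hq : q ≠ c.haltOf) {z : ℕ} (hz : z + 1 = h ∨ z = h + 1) :
    c.localAt d (encCell c.blankOf T h r q) z =
      c.nearRule (encCell c.blankOf T h r q h) (encCell c.blankOf T h r q z) := by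
  have := roleAt_le (h := h) (r := r) (z := z) (by omega)
  rw [localAt, localRule, headNear_encCell _ hr, if_pos (Or.inr hz),
    if_neg (encCell_self_ne_zero _ hr), stateOf_encCell_self _ hr, if_neg hq, role_encCell,
    if_neg (by omega)]

theorem localAt_halt (hr : r = 2 ∨ r = 3) (z : ℕ) :
    c.localAt d (encCell c.blankOf T h r c.haltOf) z = plainCell c.blankOf T z := by
  have hr2 : 2 ≤ r := by omega
  by_cases hz : z = h ∨ z + 1 = h ∨ z = h + 1
  · rw [localAt, localRule, headNear_encCell _ hr2, if_pos hz,
      if_neg (encCell_self_ne_zero _ hr2), stateOf_encCell_self _ hr2, if_pos rfl, symb_encCell,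
      plain_phase_encCell]
  · rw [localAt_far hr2 hz, encCell, plainCell, roleAt, if_neg (by tauto), if_neg (by omega),
      if_neg (by tauto)]

theorem localAt_stay (hr : r = 2 ∨ r = 3) (hq : q ≠ c.haltOf) {a' q' : ℕ}
    (hδ : c.deltaOf (T h) q = (a', q', 1)) (z : ℕ) :
    c.localAt d (encCell c.blankOf T h r q) z =
      encCell c.blankOf (Function.update T h a') h r q' z := by
  have hr2 : 2 ≤ r := by omega
  by_cases hz : z = h
  · subst hz
    rw [localAt_head hr2 hq, headRule, action_encCell hr2, hδ, if_pos rfl,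
      phase_encCell_self _ hr2, role_encCell, encCell, if_pos rfl, Function.update_self]
  · have : encCell c.blankOf (Function.update T h a') h r q' z = encCell c.blankOf T h r q z := by
      rw [encCell, encCell, Function.update_of_ne hz, if_neg hz, if_neg hz]
    rw [this]
    by_cases hz' : z + 1 = h ∨ z = h + 1
    · rw [localAt_near hr2 hq hz', nearRule, action_encCell hr2, hδ, if_pos rfl]
    · exact localAt_far hr2 (by omega)

theorem encCell_far {h' r' q' a' z b : ℕ} (hz : ¬(z = h ∨ z + 1 = h ∨ z = h + 1))
    (hh : (h' = h + 1 ∧ r' = 2) ∨ (h' + 1 = h ∧ r' = 3)) :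
    encCell b (Function.update T h a') h' r' q' z = encCell b T h r q z := by
  rw [encCell, encCell, Function.update_of_ne (by tauto), if_neg (by omega), if_neg (by tauto),
    roleAt, if_neg (by omega), if_neg (by omega), roleAt, if_neg (by omega), if_neg (by omega)]

theorem nearRule_enter {e : ℕ} (hr : 2 ≤ r) {a' q' mv : ℕ}
    (hδ : c.deltaOf (T h) q = (a', q', mv)) (hmv : mv ≠ 1)
    (he : mv = if role e = 1 then 2 * (r - 2) else 2 * (3 - r)) :
    c.nearRule (encCell c.blankOf T h r q h) e =
      packCell c.blankOf ((h % 3 + (if mv = 0 then 2 else 1)) % 3) (symb c.blankOf e)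
        (if mv = 0 then 3 else 2) q' := by
  rw [nearRule, action_encCell hr, hδ, if_neg hmv, role_encCell, roleAt_self, if_pos he,
    phase_encCell_self _ hr]

theorem nearRule_other {z : ℕ} (hr : 2 ≤ r) {a' q' mv : ℕ}
    (hδ : c.deltaOf (T h) q = (a', q', mv)) (hmv : mv ≠ 1)
    (he : mv ≠ if roleAt h r z = 1 then 2 * (r - 2) else 2 * (3 - r)) :
    c.nearRule (encCell c.blankOf T h r q h) (encCell c.blankOf T h r q z) =
      plainCell c.blankOf T z := by
  rw [nearRule, action_encCell hr, hδ, if_neg hmv, role_encCell, role_encCell, roleAt_self,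
    if_neg he, symb_encCell, plain_phase_encCell]

theorem localAt_right (hr : r = 2 ∨ r = 3) (hq : q ≠ c.haltOf) {a' q' : ℕ}
    (hδ : c.deltaOf (T h) q = (a', q', 2)) (z : ℕ) :
    c.localAt d (encCell c.blankOf T h r q) z =
      encCell c.blankOf (Function.update T h a') (h + 1) 2 q' z := by
  have hr2 : 2 ≤ r := by omega
  by_cases hz : z = h
  · subst hz
    rw [localAt_head hr2 hq, headRule, action_encCell hr2, hδ, if_neg (by simp), if_neg (by simp),
      phase_encCell_self _ hr2, encCell, Function.update_self, if_neg (by omega), roleAt,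
      if_neg (by omega), if_pos (by omega)]
  by_cases hz1 : z = h + 1
  · subst hz1
    rw [localAt_near hr2 hq (Or.inr rfl), nearRule_enter hr2 hδ (by simp), symb_encCell, encCell,
      Function.update_of_ne (by omega), roleAt_self, if_pos rfl]
    · congr 1; simp [Nat.add_mod]
    · have := roleAt_eq_one (r := r) hz
      rw [role_encCell]; split_ifs <;> omega
  by_cases hz2 : z + 1 = h
  · rw [localAt_near hr2 hq (Or.inl hz2), nearRule_other hr2 hδ (by simp), encCell, plainCell,
      Function.update_of_ne (by omega), roleAt, if_neg (by omega), if_neg (by omega),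
      if_neg (by omega)]
    have := roleAt_eq_one (r := r) hz
    split_ifs <;> omega
  · rw [localAt_far hr2 (by omega), encCell_far (by omega) (by omega)]

theorem localAt_left (hr : r = 2 ∨ r = 3) (hq : q ≠ c.haltOf) {a' q' : ℕ}
    (hδ : c.deltaOf (T (h + 1)) q = (a', q', 0)) (z : ℕ) :
    c.localAt d (encCell c.blankOf T (h + 1) r q) z =
      encCell c.blankOf (Function.update T (h + 1) a') h 3 q' z := by
  have hr2 : 2 ≤ r := by omega
  by_cases hz : z = h + 1
  · subst hz
    -- Away from cell `0` no neighbour can pass for a mirror image of the head, since it has role at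
    -- most `1`.
    have hne : ∀ z, z ≠ h + 1 →
        encCell c.blankOf T (h + 1) r q z ≠ encCell c.blankOf T (h + 1) r q (h + 1) := by
      intro z hz e
      have := congrArg role e
      rw [role_encCell, role_encCell, roleAt_self] at this
      have := roleAt_le (h := h + 1) (r := r) hz
      omega
    rw [localAt_head hr2 hq, headRule, action_encCell hr2, hδ, if_neg (by simp),
      if_neg (by simp [hne]), phase_encCell_self _ hr2, encCell, Function.update_self,
      if_neg (by omega), roleAt, if_neg (by omega), if_pos (by omega)]
  by_cases hz1 : z = h
  · subst hz1
    rw [localAt_near hr2 hq (Or.inl rfl), nearRule_enter hr2 hδ (by simp), symb_encCell, encCell,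
      Function.update_of_ne (by omega), roleAt_self, if_pos rfl]
    -- Adding `2` modulo `3` to the phase of `h + 1` gives that of `h`.
    · rw [if_pos rfl, if_pos rfl]; congr 1; omega
    · have := roleAt_eq_one (r := r) hz
      rw [role_encCell]; split_ifs <;> omega
  by_cases hz2 : z = h + 1 + 1
  · rw [localAt_near hr2 hq (Or.inr hz2), nearRule_other hr2 hδ (by simp), encCell, plainCell,
      Function.update_of_ne (by omega), roleAt, if_neg (by omega), if_neg (by omega),
      if_neg (by omega)]
    have := roleAt_eq_one (r := r) hz
    split_ifs <;> omega
  · rw [localAt_far hr2 (by omega), encCell_far (by omega) (by omega)]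

/-- With role `3` the companion is cell `1`, so it sees the head move away and drops its mark, while
the head erases itself. -/
theorem localAt_neg (hr : r = 3) (hq : q ≠ c.haltOf) {a' q' : ℕ}
    (hδ : c.deltaOf (T 0) q = (a', q', 0)) (z : ℕ) :
    c.localAt d (encCell c.blankOf T 0 r q) z =
      plainCell c.blankOf (if d = 0 then T else Function.update T 0 a') z := by
  have hr2 : 2 ≤ r := by omega
  by_cases hz : z = 0
  · subst hz
    rw [localAt_head hr2 hq, headRule, action_encCell hr2, hδ, if_neg (by simp),
      if_pos ⟨rfl, Or.inl rfl⟩, phase_encCell_self _ hr2, symb_encCell, plainCell]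
    split_ifs <;> simp
  have hT : plainCell c.blankOf (if d = 0 then T else Function.update T 0 a') z =
      plainCell c.blankOf T z := by
    unfold plainCell
    split_ifs <;> simp [hz]
  rw [hT]
  by_cases hz2 : z = 0 + 1
  · rw [localAt_near hr2 hq (Or.inr hz2), nearRule_other hr2 hδ (by simp)]
    have := roleAt_eq_one (r := r) hz
    split_ifs <;> omega
  · rw [localAt_far hr2 (by omega), encCell, plainCell, if_neg hz, roleAt, if_neg hz,
      if_neg (by omega)]

end

end InstCode

/-! ### Simulation of the machine -/

namespace TuringMachine

open InstCode

variable {k m : ℕ}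

/-- The nonnegative side of the tape, with letters as numbers. -/
def numTape (f : ℤ → Fin k) (z : ℕ) : ℕ := f z

theorem numTape_update (f : ℤ → Fin k) (h : ℕ) (a : Fin k) :
    numTape (Function.update f h a) = Function.update (numTape f) h a := by
  funext z
  by_cases hz : z = h
  · subst hz; simp [numTape]
  · simp [numTape, Function.update_of_ne, hz]

variable (M : TuringMachine (Fin k) (Fin m)) (w : List (Fin k))

theorem deltaOf_instanceCode (a : Fin k) (q : Fin m) : deltaOf (M.instanceCode w) a q =
    (((M.δ (a, q)).1 : ℕ), ((M.δ (a, q)).2.1 : ℕ), (M.δ (a, q)).2.2.code) := by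
  simp [deltaOf, instanceCode, List.getD]

@[simp] theorem startOf_instanceCode : startOf (M.instanceCode w) = M.start := rfl
@[simp] theorem blankOf_instanceCode : blankOf (M.instanceCode w) = M.blank := rfl

theorem configAt_succ (t : ℕ) : M.configAt w (t + 1) = M.step (M.configAt w t) :=
  Function.iterate_succ_apply' _ _ _

theorem step_of_ne {c : Config (Fin k) (Fin m)} (h : c.state ≠ M.halt) : M.step c =
    { state := (M.δ (c.tape c.head, c.state)).2.1
      head := c.head + (M.δ (c.tape c.head, c.state)).2.2.shift
      tape := Function.update c.tape c.head (M.δ (c.tape c.head, c.state)).1 } := if_neg h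

/-- At time `t` the cells encode the running machine. -/
def Running (d t : ℕ) : Prop :=
  ∃ h r : ℕ, (M.configAt w t).head = h ∧ (r = 3 ∨ (r = 2 ∧ 1 ≤ h)) ∧
    cellAt (M.instanceCode w) d t =
      encCell M.blank (numTape (M.configAt w t).tape) h r (M.configAt w t).state

theorem cellAt_succ (c : InstCode) (d t : ℕ) : c.cellAt d (t + 1) = c.localAt d (c.cellAt d t) :=
  rfl

theorem running_zero (d : ℕ) : M.Running w d 0 := by
  refine ⟨0, 3, rfl, Or.inl rfl, ?_⟩
  funext z
  have hw : (w.map Fin.val).getD (z - 1) M.blank = (w.getD (z - 1) M.blank : Fin k) := by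
    rw [← List.getD_map (f := Fin.val)]
  have h2 : (M.instanceCode w).2 = w.map Fin.val := rfl
  simp only [cellAt, initCell, encCell, configAt, init, Function.iterate_zero, id, numTape,
    blankOf_instanceCode, startOf_instanceCode, h2, hw]
  congr 1
  · rcases Nat.eq_zero_or_pos z with rfl | hz
    · simp
    · rw [if_neg (by omega), if_pos (by omega)]
      congr 3; omega
  · simp [roleAt]

variable {M w} {d t : ℕ}

theorem Running.cellAt_succ_halt (hR : M.Running w d t) (hq : (M.configAt w t).state = M.halt) :
    cellAt (M.instanceCode w) d (t + 1) = plainCell M.blank (numTape (M.configAt w t).tape) := by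
  obtain ⟨h, r, -, hr, he⟩ := hR
  funext z
  rw [cellAt_succ, he, hq]
  exact localAt_halt (c := M.instanceCode w) (by omega) z

variable (M w t) in
theorem deltaOf_head (h : ℕ) :
    deltaOf (M.instanceCode w) (numTape (M.configAt w t).tape h) (M.configAt w t).state =
      (((M.δ ((M.configAt w t).tape h, (M.configAt w t).state)).1 : ℕ),
        ((M.δ ((M.configAt w t).tape h, (M.configAt w t).state)).2.1 : ℕ),
        (M.δ ((M.configAt w t).tape h, (M.configAt w t).state)).2.2.code) :=
  deltaOf_instanceCode M w _ _

theorem Running.succ (hR : M.Running w d t) (hq : (M.configAt w t).state ≠ M.halt)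
    (hpos : 0 ≤ (M.configAt w (t + 1)).head) : M.Running w d (t + 1) := by
  obtain ⟨h, r, hh, hr, he⟩ := hR
  have hδ := deltaOf_head M w t h
  have hq' : ((M.configAt w t).state : ℕ) ≠ haltOf (M.instanceCode w) :=
    fun e => hq (Fin.ext e)
  rw [Running, cellAt_succ, he]
  rw [configAt_succ, step_of_ne M hq, hh] at hpos ⊢
  dsimp only at hpos ⊢
  rw [numTape_update]
  have hr' : r = 2 ∨ r = 3 := by omega
  revert hδ hpos
  generalize M.δ ((M.configAt w t).tape h, (M.configAt w t).state) = out
  obtain ⟨a, q, mv⟩ := out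
  intro hpos hδ
  cases mv with
  | L =>
    obtain ⟨h, rfl⟩ : ∃ h', h = h' + 1 :=
      ⟨h - 1, by simp only [HeadMove.shift] at hpos; omega⟩
    refine ⟨h, 3, by simp [HeadMove.shift], Or.inl rfl, ?_⟩
    funext z
    exact localAt_left (c := M.instanceCode w) hr' hq' hδ z
  | S =>
    refine ⟨h, r, by simp [HeadMove.shift], hr, ?_⟩
    funext z
    exact localAt_stay (c := M.instanceCode w) hr' hq' hδ z
  | R =>
    refine ⟨h + 1, 2, by simp [HeadMove.shift], Or.inr ⟨rfl, by omega⟩, ?_⟩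
    funext z
    exact localAt_right (c := M.instanceCode w) hr' hq' hδ z

theorem Running.cellAt_succ_neg (hR : M.Running w d t) (hq : (M.configAt w t).state ≠ M.halt)
    (hneg : (M.configAt w (t + 1)).head < 0) :
    cellAt (M.instanceCode w) d (t + 1) = plainCell M.blank
      (numTape (M.configAt w (if d = 0 then t else t + 1)).tape) := by
  obtain ⟨h, r, hh, hr, he⟩ := hR
  have hδ := deltaOf_head M w t h
  have hq' : ((M.configAt w t).state : ℕ) ≠ haltOf (M.instanceCode w) :=
    fun e => hq (Fin.ext e)
  have hT : numTape (M.configAt w (if d = 0 then t else t + 1)).tape =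
      if d = 0 then numTape (M.configAt w t).tape else
        Function.update (numTape (M.configAt w t).tape) h
          (M.δ ((M.configAt w t).tape h, (M.configAt w t).state)).1 := by
    split_ifs
    · rfl
    · rw [configAt_succ, step_of_ne M hq, hh, numTape_update]
  rw [hT, cellAt_succ, he]
  rw [configAt_succ, step_of_ne M hq, hh] at hneg
  revert hδ hneg
  generalize M.δ ((M.configAt w t).tape h, (M.configAt w t).state) = out
  obtain ⟨a, q, mv⟩ := out
  intro hneg hδ
  cases mv with
  | L =>
    obtain rfl : h = 0 := by simp only [HeadMove.shift] at hneg; omega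
    funext z
    exact localAt_neg (c := M.instanceCode w) (by omega) hq' hδ z
  | S => simp only [HeadMove.shift] at hneg; omega
  | R => simp only [HeadMove.shift] at hneg; omega

theorem cellAt_plain {T : ℕ → ℕ} {t s : ℕ} (hts : t ≤ s)
    (ht : cellAt (M.instanceCode w) d t = plainCell M.blank T) :
    cellAt (M.instanceCode w) d s = plainCell M.blank T := by
  induction s, hts using Nat.le_induction with
  | base => exact ht
  | succ s hs ih =>
    rw [cellAt_succ, ih]
    funext z
    exact localAt_plain (c := M.instanceCode w) z

variable (M w d) in
theorem running_or_plain (t : ℕ) : M.Running w d t ∨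
    ∃ f : ℤ → Fin k, cellAt (M.instanceCode w) d t = plainCell M.blank (numTape f) := by
  induction t with
  | zero => exact Or.inl (running_zero M w d)
  | succ t ih =>
    rcases ih with hR | ⟨f, hf⟩
    · by_cases hq : (M.configAt w t).state = M.halt
      · exact Or.inr ⟨_, hR.cellAt_succ_halt hq⟩
      · rcases lt_or_ge (M.configAt w (t + 1)).head 0 with h | h
        · exact Or.inr ⟨_, hR.cellAt_succ_neg hq h⟩
        · exact Or.inl (hR.succ hq h)
    · exact Or.inr ⟨f, cellAt_plain t.le_succ hf⟩

variable (M w d) in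
theorem cellAt_eq_packCell (t z : ℕ) : ∃ a r q, a < k ∧ r ≤ 3 ∧ q < m ∧
    cellAt (M.instanceCode w) d t z = packCell M.blank (z % 3) a r q := by
  have hm : 0 < m := M.start.pos
  rcases running_or_plain M w d t with ⟨h, r, -, hr, he⟩ | ⟨f, hf⟩
  · refine ⟨_, _, _, ((M.configAt w t).tape z).isLt, ?_, ?_, by rw [he]; rfl⟩
    · unfold roleAt; split_ifs <;> omega
    · split_ifs
      · exact Fin.isLt _
      · exact hm
  · exact ⟨_, 0, 0, (f z).isLt, by omega, hm, by rw [hf]; rfl⟩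

variable (M w d) in
-- Equal nonzero cells have equal phases, but `z - 1` and `z + 1` differ modulo `3` for `z > 0`. For
-- `z = 0` the left neighbour is cell `0` itself.
theorem separated_instanceCode : Separated (M.instanceCode w) d := by
  intro t z h
  by_contra! hcon
  obtain ⟨hne, h0⟩ := hcon
  have hz : 0 < z := by
    rcases Nat.eq_zero_or_pos z with rfl | hz
    · simp at hne
    · exact hz
  have h0' := h0
  obtain ⟨a, r, q, -, -, -, h1⟩ := cellAt_eq_packCell M w d t (z - 1)
  obtain ⟨a', r', q', -, -, -, h2⟩ := cellAt_eq_packCell M w d t (z + 1)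
  rw [h1] at h0
  rw [h, h2] at h0'
  have := congrArg phase h
  rw [h1, h2, phase_packCell h0, phase_packCell h0'] at this
  omega

theorem exists_cellAt_ne_zero (hR : M.Running w d t) :
    ∃ z, cellAt (M.instanceCode w) d t z ≠ 0 := by
  obtain ⟨h, r, -, hr, he⟩ := hR
  exact ⟨h, by rw [he]; exact encCell_self_ne_zero _ (by omega)⟩

/-- Without a head the local rule changes nothing, so the cells from time `t` on are constant. -/
theorem eventually_zero_iff_of_plain {f : ℤ → Fin k}
    (hf : cellAt (M.instanceCode w) d t = plainCell M.blank (numTape f)) :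
    (∃ T, ∀ τ, T ≤ τ → ∀ z, cellAt (M.instanceCode w) d τ z = 0) ↔
      ∀ z : ℕ, f z = M.blank := by
  have key : ∀ z : ℕ, plainCell M.blank (numTape f) z = 0 ↔ f z = M.blank := by
    intro z
    rw [plainCell, packCell_eq_zero]
    simp [numTape, Fin.ext_iff]
  constructor
  · rintro ⟨T, hT⟩ z
    have := hT (max t T) (le_max_right _ _) z
    rw [cellAt_plain (le_max_left _ _) hf] at this
    exact (key z).1 this
  · intro h
    refine ⟨t, fun τ hτ z => ?_⟩
    rw [cellAt_plain hτ hf]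
    exact (key z).2 (h z)

theorem running_of_forall (h0 : ∀ s ≤ t, 0 ≤ (M.configAt w s).head)
    (hq : ∀ s < t, (M.configAt w s).state ≠ M.halt) : M.Running w d t := by
  induction t with
  | zero => exact running_zero M w d
  | succ t ih =>
    exact (ih (fun s hs => h0 s (by omega)) (fun s hs => hq s (by omega))).succ
      (hq t (by omega)) (h0 _ le_rfl)

theorem configAt_of_halt {s : ℕ} (hq : (M.configAt w t).state = M.halt) (hts : t ≤ s) :
    M.configAt w s = M.configAt w t := by
  induction s, hts using Nat.le_induction with
  | base => rfl
  | succ s hs ih => rw [configAt_succ, ih, step, if_pos hq]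

/-- As long as the head was not on the negative side, that side is blank. -/
theorem tape_neg (h0 : ∀ s < t, 0 ≤ (M.configAt w s).head) {z : ℤ} (hz : z < 0) :
    (M.configAt w t).tape z = M.blank := by
  induction t with
  | zero => exact if_neg (by omega)
  | succ t ih =>
    have ih := ih fun s hs => h0 s (by omega)
    have := h0 t (by omega)
    rw [configAt_succ, step]
    split_ifs
    · exact ih
    · dsimp only
      rw [Function.update_of_ne (by omega), ih]

theorem tapeClearAt_iff (h0 : ∀ s < t, 0 ≤ (M.configAt w s).head) :
    M.TapeClearAt w t ↔ ∀ z : ℕ, (M.configAt w t).tape z = M.blank := by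
  refine ⟨fun h z => h z, fun h z => ?_⟩
  rcases lt_or_ge z 0 with hz | hz
  · exact tape_neg h0 hz
  · obtain ⟨z, rfl⟩ := Int.eq_ofNat_of_zero_le hz
    exact h z

/-- A halted configuration is constant, so its head could not move to the negative side later. -/
theorem FirstNegStepAt.not_halt (h : M.FirstNegStepAt w t) {s : ℕ} (hs : s ≤ t) :
    (M.configAt w s).state ≠ M.halt := by
  intro hq
  have h1 := h.2
  rw [configAt_of_halt hq (by omega)] at h1
  exact absurd (h.1 s hs) (by omega)

theorem FirstNegStepAt.unique {t' : ℕ} (h : M.FirstNegStepAt w t) (h' : M.FirstNegStepAt w t') :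
    t = t' := by
  rcases lt_trichotomy t t' with hlt | rfl | hlt
  · exact absurd (h'.1 (t + 1) hlt) (by have := h.2; omega)
  · rfl
  · exact absurd (h.1 (t' + 1) hlt) (by have := h'.2; omega)

variable (M w) in
theorem eventually_zero_iff (hd : d = 0 ∨ d = 1) :
    (∃ T, ∀ τ, T ≤ τ → ∀ z, cellAt (M.instanceCode w) d τ z = 0) ↔
      (M.StopsClearWithoutNegStep w ∨
        ∃ t : ℕ, M.FirstNegStepAt w t ∧ M.TapeClearAt w (t + d)) := by
  by_cases hH : ∃ t, (M.configAt w t).state = M.halt ∧ ∀ s ≤ t, 0 ≤ (M.configAt w s).head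
  · classical
    -- The first halting time is needed: the automaton freezes one step after it, whereas
    -- `StopsClearWithoutNegStep` admits any later time.
    obtain ⟨hq, h0⟩ := Nat.find_spec hH
    have hmin : ∀ s < Nat.find hH, (M.configAt w s).state ≠ M.halt := fun s hs hs' =>
      Nat.find_min hH hs ⟨hs', fun u hu => h0 u (by omega)⟩
    generalize Nat.find hH = t at hq h0 hmin
    have hR : M.Running w d t := running_of_forall h0 hmin
    rw [eventually_zero_iff_of_plain (hR.cellAt_succ_halt hq),
      ← tapeClearAt_iff fun s hs => h0 s hs.le]
    constructor
    · exact fun h => Or.inl ⟨t, hq, h, h0⟩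
    · rintro (⟨t', hq', hcl, -⟩ | ⟨t', ht', -⟩)
      · intro z
        have e : M.configAt w t = M.configAt w t' := by
          rcases le_total t t' with hle | hle
          · exact (configAt_of_halt hq hle).symm
          · exact configAt_of_halt hq' hle
        rw [e]; exact hcl z
      · rcases le_or_gt t t' with hle | hlt
        · exact absurd hq (ht'.not_halt hle)
        · exact absurd (h0 (t' + 1) hlt) (by have := ht'.2; omega)
  have hS : ¬ M.StopsClearWithoutNegStep w := fun ⟨t, hq, _, h0⟩ => hH ⟨t, hq, h0⟩
  by_cases hN : ∃ t, M.FirstNegStepAt w t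
  · obtain ⟨t, ht⟩ := hN
    have hR : M.Running w d t := running_of_forall ht.1 fun s hs => ht.not_halt hs.le
    have htd : (if d = 0 then t else t + 1) = t + d := by
      rcases hd with rfl | rfl <;> simp
    have hf := hR.cellAt_succ_neg (ht.not_halt le_rfl) ht.2
    rw [htd] at hf
    rw [eventually_zero_iff_of_plain hf,
      ← tapeClearAt_iff fun s hs => ht.1 s (by omega)]
    refine ⟨fun h => Or.inr ⟨t, ht, h⟩, fun h => ?_⟩
    obtain ⟨t', ht', h⟩ := h.resolve_left hS
    rwa [ht.unique ht']
  -- Without a first negative step there is no negative step at all, so the simulation never ends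
  -- and a head is always visible.
  · have h0 : ∀ t, ∀ s ≤ t, 0 ≤ (M.configAt w s).head := by
      intro t
      induction t with
      | zero => intro s hs; obtain rfl : s = 0 := by omega
                exact le_rfl
      | succ t ih =>
        intro s hs
        by_contra hneg
        rcases Nat.lt_or_ge s (t + 1) with hlt | hge
        · exact hneg (ih s (by omega))
        · obtain rfl : s = t + 1 := by omega
          exact hN ⟨t, ih, by omega⟩
    constructor
    · rintro ⟨T, hT⟩
      obtain ⟨z, hz⟩ := exists_cellAt_ne_zero (d := d)
        (running_of_forall (h0 T) fun s _ hq => hH ⟨s, hq, h0 s⟩)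
      exact absurd (hT T le_rfl z) hz
    · rintro (h | ⟨t, ht, -⟩)
      · exact absurd h hS
      · exact absurd ⟨t, ht⟩ hN

end TuringMachine

namespace InstCode

/-! ### Computability -/

section
variable {α : Type*} [Primcodable α] {c : α → InstCode} {f g h i j : α → ℕ}

theorem primrec_deltaOf (hc : Primrec c) (hf : Primrec f) (hg : Primrec g) :
    Primrec fun x => (c x).deltaOf (f x) (g x) := by
  have ht : Primrec fun x => (c x).1.2.2.2.2.2 :=
    .comp .snd (.comp .snd (.comp .snd (.comp .snd (.comp .snd (.comp .fst hc)))))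
  exact (Primrec.list_getD (0, 0, 0)).comp ((Primrec.list_getD []).comp ht hf) hg

theorem primrec_startOf (hc : Primrec c) : Primrec fun x => (c x).startOf := by
  have h : Primrec fun x => (c x).1.2.2.1 :=
    .comp .fst (.comp .snd (.comp .snd (.comp .fst hc)))
  exact h

theorem primrec_haltOf (hc : Primrec c) : Primrec fun x => (c x).haltOf := by
  have h : Primrec fun x => (c x).1.2.2.2.1 :=
    .comp .fst (.comp .snd (.comp .snd (.comp .snd (.comp .fst hc))))
  exact h

theorem primrec_blankOf (hc : Primrec c) : Primrec fun x => (c x).blankOf := by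
  have h : Primrec fun x => (c x).1.2.2.2.2.1 :=
    .comp .fst (.comp .snd (.comp .snd (.comp .snd (.comp .snd (.comp .fst hc)))))
  exact h

theorem primrec_lead (hc : Primrec c) : Primrec fun x => (c x).lead :=
  Primrec.nat_add.comp (Primrec.list_length.comp (.comp .snd hc)) (.const 2)

theorem primrec_unpair_fst (hf : Primrec f) : Primrec fun x => (f x).unpair.1 :=
  .comp .fst (Primrec.unpair.comp hf)

theorem primrec_unpair_snd (hf : Primrec f) : Primrec fun x => (f x).unpair.2 :=
  .comp .snd (Primrec.unpair.comp hf)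

theorem primrecPred_eq (hf : Primrec f) (hg : Primrec g) : PrimrecPred fun x => f x = g x :=
  Primrec.eq.comp hf hg

theorem primrec_sub_one (hf : Primrec f) : Primrec fun x => f x - 1 :=
  Primrec.nat_sub.comp hf (.const 1)

theorem primrec_phase (hf : Primrec f) : Primrec fun x => phase (f x) :=
  primrec_unpair_fst (primrec_unpair_fst (primrec_sub_one hf))

theorem primrec_role (hf : Primrec f) : Primrec fun x => role (f x) :=
  primrec_unpair_fst (primrec_unpair_snd (primrec_sub_one hf))

theorem primrec_stateOf (hf : Primrec f) : Primrec fun x => stateOf (f x) :=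
  primrec_unpair_snd (primrec_unpair_snd (primrec_sub_one hf))

theorem primrec_symb (hf : Primrec f) (hg : Primrec g) : Primrec fun x => symb (f x) (g x) :=
  .ite (primrecPred_eq hg (.const 0)) hf
    (primrec_unpair_snd (primrec_unpair_fst (primrec_sub_one hg)))

theorem primrec_packCell (hf : Primrec f) (hg : Primrec g) (hh : Primrec h) (hi : Primrec i)
    (hj : Primrec j) : Primrec fun x => packCell (f x) (g x) (h x) (i x) (j x) :=
  .ite ((primrecPred_eq hh hf).and (primrecPred_eq hi (.const 0))) (.const 0)
    (Primrec.succ.comp (Primrec₂.natPair.comp (Primrec₂.natPair.comp hg hh)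
      (Primrec₂.natPair.comp hi hj)))

theorem primrecPred_head (hf : Primrec f) : PrimrecPred fun x => 2 ≤ role (f x) :=
  Primrec.nat_le.comp (.const 2) (primrec_role hf)

theorem primrec_headPart (hf : Primrec f) : Primrec fun x => headPart (f x) :=
  .ite (primrecPred_head hf) hf (.const 0)

theorem primrec_headNear (hf : Primrec f) (hg : Primrec g) (hh : Primrec h) :
    Primrec fun x => headNear (f x) (g x) (h x) :=
  .ite (primrecPred_head hg) hg
    (Primrec.nat_max.comp (primrec_headPart hf) (primrec_headPart hh))

theorem primrec_action (hc : Primrec c) (hf : Primrec f) : Primrec fun x => (c x).action (f x) :=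
  primrec_deltaOf hc (primrec_symb (primrec_blankOf hc) hf) (primrec_stateOf hf)

theorem primrec_headRule (d : ℕ) (hc : Primrec c) (hf : Primrec f) (hg : Primrec g)
    (hh : Primrec h) : Primrec fun x => (c x).headRule d (f x) (g x) (h x) := by
  have hb := primrec_blankOf hc
  have ha := primrec_action hc hg
  have ha1 : Primrec fun x => ((c x).action (g x)).1 := .comp .fst ha
  have ha2 : Primrec fun x => ((c x).action (g x)).2.1 := .comp .fst (.comp .snd ha)
  have ha3 : Primrec fun x => ((c x).action (g x)).2.2 := .comp .snd (.comp .snd ha)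
  have hp := primrec_phase hg
  refine .ite (primrecPred_eq ha3 (.const 1)) (primrec_packCell hb hp ha1 (primrec_role hg) ha2)
    (.ite ((primrecPred_eq ha3 (.const 0)).and ((primrecPred_eq hf hg).or (primrecPred_eq hh hg)))
      (primrec_packCell hb hp ?_ (.const 0) (.const 0))
      (primrec_packCell hb hp ha1 (.const 1) (.const 0)))
  split_ifs
  · exact primrec_symb hb hg
  · exact ha1

theorem primrec_nearRule (hc : Primrec c) (hf : Primrec f) (hg : Primrec g) :
    Primrec fun x => (c x).nearRule (f x) (g x) := by
  have hb := primrec_blankOf hc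
  have ha := primrec_action hc hf
  have ha2 : Primrec fun x => ((c x).action (f x)).2.1 := .comp .fst (.comp .snd ha)
  have ha3 : Primrec fun x => ((c x).action (f x)).2.2 := .comp .snd (.comp .snd ha)
  have hl : PrimrecPred fun x => ((c x).action (f x)).2.2 = 0 := primrecPred_eq ha3 (.const 0)
  have hs := primrec_symb hb hg
  have hr := primrec_role hf
  exact .ite (primrecPred_eq ha3 (.const 1)) hg
    (.ite (primrecPred_eq ha3 (.ite (primrecPred_eq (primrec_role hg) (.const 1))
        (Primrec.nat_mul.comp (.const 2) (Primrec.nat_sub.comp hr (.const 2)))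
        (Primrec.nat_mul.comp (.const 2) (Primrec.nat_sub.comp (.const 3) hr))))
      (primrec_packCell hb (Primrec.nat_mod.comp (Primrec.nat_add.comp (primrec_phase hf)
          (.ite hl (.const 2) (.const 1))) (.const 3)) hs (.ite hl (.const 3) (.const 2)) ha2)
      (primrec_packCell hb (primrec_phase hg) hs (.const 0) (.const 0)))

theorem primrec_localRule (d : ℕ) (hc : Primrec c) (hf : Primrec f) (hg : Primrec g)
    (hh : Primrec h) : Primrec fun x => (c x).localRule d (f x) (g x) (h x) := by
  have hb := primrec_blankOf hc
  have hn := primrec_headNear hf hg hh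
  exact .ite (primrecPred_eq hn (.const 0)) hg
    (.ite (primrecPred_eq (primrec_stateOf hn) (primrec_haltOf hc))
      (primrec_packCell hb (primrec_phase hg) (primrec_symb hb hg) (.const 0) (.const 0))
      (.ite (primrecPred_head hg) (primrec_headRule d hc hf hg hh) (primrec_nearRule hc hn hg)))

theorem primrec_initCell (hc : Primrec c) (hf : Primrec f) :
    Primrec fun x => (c x).initCell (f x) := by
  have hb := primrec_blankOf hc
  have h0 : PrimrecPred fun x => f x = 0 := primrecPred_eq hf (.const 0)
  have hw : Primrec fun x => (c x).2.getD (f x - 1) (c x).blankOf := by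
    simp only [List.getD_eq_getElem?_getD]
    exact Primrec.option_getD.comp
      (Primrec.list_getElem?.comp (.comp .snd hc) (primrec_sub_one hf)) hb
  exact primrec_packCell hb (Primrec.nat_mod.comp hf (.const 3)) (.ite h0 hb hw)
    (.ite h0 (.const 3) (.ite (primrecPred_eq hf (.const 1)) (.const 1) (.const 0)))
    (.ite h0 (primrec_startOf hc) (.const 0))

theorem primrec_st (hf : Primrec f) (hg : Primrec g) (hh : Primrec h) :
    Primrec fun x => st (f x) (g x) (h x) :=
  Primrec₂.natPair.comp hf (Primrec₂.natPair.comp hg hh)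

theorem primrec_kd (hf : Primrec f) : Primrec fun x => kd (f x) := primrec_unpair_fst hf

theorem primrec_lo (hf : Primrec f) : Primrec fun x => lo (f x) :=
  primrec_unpair_fst (primrec_unpair_snd hf)

theorem primrec_hi (hf : Primrec f) : Primrec fun x => hi (f x) :=
  primrec_unpair_snd (primrec_unpair_snd hf)

theorem primrec_cellSt (hf : Primrec f) : Primrec fun x => cellSt (f x) :=
  .ite (primrecPred_eq hf (.const 0)) (.const 0) (primrec_st (.const 1) hf (.const 0))

theorem primrec_pairSt (hf : Primrec f) (hg : Primrec g) : Primrec fun x => pairSt (f x) (g x) :=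
  .ite (primrecPred_eq (Primrec.nat_max.comp hf hg) (.const 0)) (.const 0)
    (primrec_st (.const 2) (Primrec.nat_min.comp hf hg) (Primrec.nat_max.comp hf hg))

theorem primrec_labelSt (hc : Primrec c) (hf : Primrec f) (hg : Primrec g) :
    Primrec fun x => (c x).labelSt (f x) (g x) :=
  .ite (Primrec.nat_lt.comp (Primrec.nat_add.comp hf hg)
      (Primrec.succ.comp (Primrec.nat_mul.comp (.const 2) (primrec_lead hc))))
    (primrec_st (.const 3) hf hg)
    (primrec_cellSt (primrec_initCell hc
      (Primrec.nat_div.comp (Primrec.nat_sub.comp hg hf) (.const 2))))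

theorem primrec_labelRule (hc : Primrec c) (hf : Primrec f) (hg : Primrec g) (hh : Primrec h)
    (hi : Primrec i) : Primrec fun x => (c x).labelRule (f x) (g x) (h x) (i x) := by
  have hm := Primrec.nat_max.comp hg hi
  exact .ite ((primrecPred_eq hg (.const 0)).or (primrecPred_eq hi (.const 0)))
    (primrec_labelSt hc (.const 1) (Primrec.succ.comp hm))
    (.ite (primrecPred_eq hf hh) (primrec_labelSt hc hm hm)
      (primrec_labelSt hc (Primrec.nat_max.comp hf hh) hm))

theorem primrec_common (hf : Primrec f) (hg : Primrec g) (hh : Primrec h)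
    (hi : Primrec i) : Primrec fun x => common (f x) (g x) (h x) (i x) :=
  .ite ((primrecPred_eq hf hh).and (primrecPred_eq hg hi)) hg
    (.ite ((primrecPred_eq hf hh).or (primrecPred_eq hf hi)) hf hg)

theorem primrec_pairRule (d : ℕ) (hc : Primrec c) (hf : Primrec f) (hg : Primrec g)
    (hh : Primrec h) (hi : Primrec i) :
    Primrec fun x => (c x).pairRule d (f x) (g x) (h x) (i x) := by
  have hm := primrec_common hf hg hh hi
  exact primrec_localRule d hc (Primrec.nat_sub.comp (Primrec.nat_add.comp hf hg) hm) hm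
    (Primrec.nat_sub.comp (Primrec.nat_add.comp hh hi) hm)

theorem primrec_rawRule (d : ℕ) (hc : Primrec c) (hf : Primrec f) (hg : Primrec g) :
    Primrec fun x => (c x).rawRule d (f x) (g x) := by
  have h1 := primrec_kd hf
  have h2 := primrec_kd hg
  have h3 := primrec_lo hf
  have h4 := primrec_lo hg
  have h5 := primrec_hi hf
  have h6 := primrec_hi hg
  exact .ite ((primrecPred_eq h1 (.const 3)).and (primrecPred_eq h2 (.const 3)))
    (primrec_labelRule hc h3 h5 h4 h6)
    (.ite ((primrecPred_eq h1 (.const 2)).or (primrecPred_eq h2 (.const 2)))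
      (primrec_cellSt (primrec_pairRule d hc h3 h5 h4 h6)) (primrec_pairSt h3 h4))

theorem primrec_rule (d : ℕ) (hc : Primrec c) (hf : Primrec f) (hg : Primrec g) :
    Primrec fun x => (c x).rule d (f x) (g x) :=
  primrec_rawRule d hc (Primrec.nat_min.comp hf hg) (Primrec.nat_max.comp hf hg)

end

/-! ### Truncation to a finite system -/

/-- A strict bound for the letters, states, roles and phases. -/
def letterBound (c : InstCode) : ℕ := c.1.1 + c.1.2.1 + 4

/-- A strict bound for the cells. -/
def cellBound (c : InstCode) : ℕ :=
  (c.letterBound * c.letterBound) * (c.letterBound * c.letterBound) + (2 * c.lead + 1)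

/-- The number of states of the finite system. -/
def size (c : InstCode) : ℕ :=
  (c.cellBound * c.cellBound) * (c.cellBound * c.cellBound)

/-- The value `0` replaces results outside the finite set; it is never needed for the development of
an actual instance. -/
def boundedRule (c : InstCode) (d s t : ℕ) : ℕ :=
  if c.rule d s t < c.size then c.rule d s t else 0

/-- The algorithm on finite descriptions. -/
def systemCode (d : ℕ) (c : InstCode) : ℕ × ℕ × ℕ × List (List ℕ) :=
  (c.size, 0, st 3 0 0,
    (List.range c.size).map fun s => (List.range c.size).map fun t => c.boundedRule d s t)

theorem primrec_size : Primrec size := by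
  have hl : Primrec letterBound := Primrec.nat_add.comp
    (Primrec.nat_add.comp (.comp .fst .fst) (.comp .fst (.comp .snd .fst))) (.const 4)
  have h2 := Primrec.nat_mul.comp hl hl
  have hb : Primrec cellBound := Primrec.nat_add.comp (Primrec.nat_mul.comp h2 h2)
    (Primrec.succ.comp (Primrec.nat_mul.comp (.const 2) (primrec_lead .id)))
  have h3 := Primrec.nat_mul.comp hb hb
  exact Primrec.nat_mul.comp h3 h3

theorem primrec_systemCode (d : ℕ) : Primrec (systemCode d) := by
  have hr : Primrec fun p : (InstCode × ℕ) × ℕ => p.1.1.boundedRule d p.1.2 p.2 := by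
    have h := primrec_rule d (c := fun p : (InstCode × ℕ) × ℕ => p.1.1) (f := fun p => p.1.2)
      (g := fun p => p.2) (.comp .fst .fst) (.comp .snd .fst) .snd
    exact .ite (Primrec.nat_lt.comp h (primrec_size.comp (.comp .fst .fst))) h (.const 0)
  have hrow : Primrec fun p : InstCode × ℕ =>
      (List.range p.1.size).map fun t => p.1.boundedRule d p.2 t :=
    Primrec.list_map (Primrec.list_range.comp (primrec_size.comp .fst)) hr
  exact .pair primrec_size (.pair (.const 0) (.pair (.const _)
    (Primrec.list_map (Primrec.list_range.comp primrec_size) hrow)))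

theorem boundedRule_lt (c : InstCode) (d s t : ℕ) : c.boundedRule d s t < c.size := by
  unfold boundedRule
  split_ifs with h
  · exact h
  · unfold size cellBound; positivity

theorem boundedRule_comm (c : InstCode) (d s t : ℕ) :
    c.boundedRule d s t = c.boundedRule d t s := by
  rw [boundedRule, boundedRule, rule_comm]

theorem one_lt_size (c : InstCode) : st 3 0 0 < c.size :=
  st_lt (by unfold cellBound lead; omega) (by unfold cellBound; omega) (by unfold cellBound; omega)

/-- The finite system of an instance. -/
def finSys (c : InstCode) (d : ℕ) : DynSys (Fin c.size) where
  f s t := ⟨c.boundedRule d s t, c.boundedRule_lt d s t⟩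
  zero := ⟨0, (Nat.zero_le _).trans_lt c.one_lt_size⟩
  one := ⟨st 3 0 0, c.one_lt_size⟩

theorem finSys_isSymmetric (c : InstCode) (d : ℕ) : (c.finSys d).IsSymmetric :=
  fun s t => Fin.ext (c.boundedRule_comm d s t)

theorem systemCode_eq (c : InstCode) (d : ℕ) : systemCode d c = (c.finSys d).code := by
  have key : ∀ {β : Type} (n : ℕ) (F : ℕ → β),
      List.ofFn (fun i : Fin n => F i) = (List.range n).map F := by
    intro β n F
    apply List.ext_getElem <;> simp
  simp only [systemCode, DynSys.code, finSys]
  rw [← key]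
  simp only [← key]

theorem finSys_dev {c : InstCode} {d : ℕ} (h : ∀ i j, (c.sys d).dev i j < c.size) (i j : ℕ) :
    ((c.finSys d).dev i j : ℕ) = (c.sys d).dev i j := by
  induction i generalizing j with
  | zero => rw [DynSys.dev, DynSys.dev]; rfl
  | succ i ih =>
    induction j with
    | zero => rw [DynSys.dev, DynSys.dev]; rfl
    | succ j ihj =>
      have hlt := h (i + 1) (j + 1)
      rw [dev_succ] at hlt
      rw [dev_succ, DynSys.dev]
      change c.boundedRule d _ _ = _
      rw [ih, ihj, boundedRule, if_pos hlt]

theorem ultimatelyZero_finSys_iff {c : InstCode} {d : ℕ}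
    (h : ∀ i j, (c.sys d).dev i j < c.size) :
    (c.finSys d).UltimatelyZero ↔ (c.sys d).UltimatelyZero := by
  simp only [DynSys.UltimatelyZero, Fin.ext_iff, finSys_dev h]
  rfl

theorem pair_lt {B u v : ℕ} (hu : u < B) (hv : v < B) : Nat.pair u v < B * B := by
  refine (Nat.pair_lt_max_add_one_sq u v).trans_le ?_
  rw [sq]; exact Nat.mul_self_le_mul_self (by omega)

end InstCode

open InstCode in
theorem TuringMachine.sys_dev_lt {k m : ℕ} (M : TuringMachine (Fin k) (Fin m))
    (w : List (Fin k)) (d i j : ℕ) :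
    (sys (M.instanceCode w) d).dev i j < size (M.instanceCode w) := by
  refine dev_lt (M.separated_instanceCode w d) (by unfold cellBound; omega) (fun τ z => ?_) i j
  obtain ⟨a, r, q, ha, hr, hq, h⟩ := M.cellAt_eq_packCell w d τ z
  rw [h, packCell]
  have hk : k + m + 4 = letterBound (M.instanceCode w) := rfl
  split_ifs
  · unfold cellBound; positivity
  · have := InstCode.pair_lt (B := letterBound (M.instanceCode w) * letterBound (M.instanceCode w))
      (InstCode.pair_lt (u := z % 3) (v := a) (B := letterBound (M.instanceCode w))
        (by omega) (by omega))
      (InstCode.pair_lt (u := r) (v := q) (B := letterBound (M.instanceCode w))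
        (by omega) (by omega))
    unfold cellBound lead
    omega

/-- `F` is the algorithm, acting on finite descriptions. The tape "at the first step into the
negative side" is read both as the tape just before that step (`d = 0`) and as the tape just after
it (`d = 1`); the statement is claimed for either reading. -/
theorem lemma3p2 (d : ℕ) (hd : d = 0 ∨ d = 1) :
    ∃ F : (ℕ × ℕ × ℕ × ℕ × ℕ × List (List (ℕ × ℕ × ℕ))) × List ℕ → ℕ × ℕ × ℕ × List (List ℕ),
      Computable F ∧
      ∀ (k m : ℕ) (M : TuringMachine (Fin k) (Fin m)) (w : List (Fin k)),
        ∃ (n : ℕ) (S : DynSys (Fin n)),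
          F (M.instanceCode w) = S.code ∧
          S.IsSymmetric ∧
          (S.UltimatelyZero ↔
            (M.StopsClearWithoutNegStep w ∨
              ∃ t : ℕ, M.FirstNegStepAt w t ∧ M.TapeClearAt w (t + d))) := by
  refine ⟨InstCode.systemCode d, (InstCode.primrec_systemCode d).to_comp, fun k m M w => ?_⟩
  refine ⟨_, InstCode.finSys (M.instanceCode w) d, InstCode.systemCode_eq _ d,
    InstCode.finSys_isSymmetric _ d, ?_⟩
  rw [InstCode.ultimatelyZero_finSys_iff (M.sys_dev_lt w d),
    InstCode.ultimatelyZero_sys_iff (M.separated_instanceCode w d), M.eventually_zero_iff w hd]
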